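/- Let $k,\lambda,\beta>0$. Let $X=(X(t))_{t\ge 0}$ be a symmetric bilateral-gamma Ornstein--Uhlenbeck (B$\Gamma$-OU) process with parameters $(k,\lambda,\beta)$, that is, a solution of $$dX(t)=-kX(t)\,dt+dZ(t),\qquad\text{i.e. a.s. } X(t)=X(0)-k\int_0^tX(r)\,dr+Z(t)\ \text{ for all } t\ge 0,$$ where $Z(t)=\sum_{n=1}^{N(t)}J_n$ is a compound Poisson process, independent of $X(0)$: $N$ is a Poisson process with intensity $\lambda$, and the jumps $J_n$ are i.i.d., independent of $N$, with the centered Laplace law with density $\tfrac{\beta}{2}e^{-\beta|x|}$. Then, for all $s,t\ge0$: (i) for every $u\in\mathbb R$, almost surely, $$E\big[e^{iuX(t+s)}\mid X(s)\big]=e^{iuX(s)e^{-kt}}\,e^{\lambda t(\varphi_{\tilde L}(u)-1)},\qquad \varphi_{\tilde L}(u)=\int_0^1\frac{\beta^2e^{2ktv}}{\beta^2e^{2ktv}+u^2}\,dv;$$ (ii) $\varphi_{\tilde L}$ is the characteristic function of the uniform mixture of centered Laplace laws with random rate $\beta e^{ktU}$, $U$ uniform on $[0,1]$, and $u\mapsto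 e^{\lambda t(\varphi_{\tilde L}(u)-1)}$ is the characteristic function of the compound Poisson law of $\sum_{i=1}^{M}\tilde J_i$, where $M$ is Poisson with mean $\lambda t$ and the $\tilde J_i$ are i.i.d. with this mixture law and independent of $M$; (iii) the increment $X(t+s)-e^{-kt}X(s)$ is independent of $X(s)$ and has this compound Poisson law. -/

import Mathlib

open MeasureTheory ProbabilityTheory
open scoped NNReal ENNReal

/-- Density of the centered Laplace law with rate `β`: `x ↦ (β / 2) e ^ (-β |x|)`, that is the
double exponential density with equal weights `1 / 2` and equal rates `β`. -/
noncomputable def laplacePDF (β x : ℝ) : ℝ≥0∞ :=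
  ENNReal.ofReal (β / 2 * Real.exp (-(β * |x|)))

/-- The centered Laplace law with rate `β` (a probability measure for `β > 0`). -/
noncomputable def laplaceMeasure (β : ℝ) : Measure ℝ :=
  volume.withDensity (laplacePDF β)

theorem measurable_laplacePDF_uncurry : Measurable (Function.uncurry laplacePDF) := by
  unfold Function.uncurry laplacePDF
  fun_prop

/-- The Laplace laws depend measurably on the rate, so that they can be mixed over the rate. -/
theorem measurable_laplaceMeasure : Measurable laplaceMeasure := by
  refine Measure.measurable_of_measurable_coe _ fun s hs => ?_
  simp only [laplaceMeasure, withDensity_apply _ hs]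
  exact Measurable.lintegral_prod_right' (ν := volume.restrict s) measurable_laplacePDF_uncurry

/-- The law of a centered Laplace variable with random rate `β e ^ (c U)`, where `U` is uniform on
`[0, 1]`: the uniform mixture over `v ∈ [0, 1]` of the centered Laplace laws with rates
`β e ^ (c v)`. -/
noncomputable def laplaceMixture (β c : ℝ) : Measure ℝ :=
  (volume.restrict (Set.Icc (0 : ℝ) 1)).bind fun v => laplaceMeasure (β * Real.exp (c * v))

/-- The `n`-fold convolution power of `ν`: the law of the sum of `n` independent variables with
law `ν`. -/
noncomputable def convPower (ν : Measure ℝ) : ℕ → Measure ℝ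
  | 0 => Measure.dirac 0
  | n + 1 => (convPower ν n).conv ν

/-- The compound Poisson law with intensity `r` and jump law `ν`: the law of `J₁ + ⋯ + J_M`, where
`M` is Poisson with mean `r` and independent of the independent variables `Jᵢ` with law `ν`. -/
noncomputable def compoundPoissonMeasure (r : ℝ≥0) (ν : Measure ℝ) : Measure ℝ :=
  Measure.sum fun n : ℕ => poissonMeasure r {n} • convPower ν n

/-- `N` is a (homogeneous) Poisson process with intensity `lam` under `P`. -/
structure IsPoissonProcess {Ω : Type*} [MeasurableSpace Ω] (lam : ℝ≥0) (N : ℝ≥0 → Ω → ℕ)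
    (P : Measure Ω) : Prop where
  measurable : ∀ t, Measurable (N t)
  zero : ∀ᵐ ω ∂P, N 0 ω = 0
  mono : ∀ᵐ ω ∂P, Monotone fun t => N t ω
  rightCont : ∀ᵐ ω ∂P, ∀ t, ContinuousWithinAt (fun r => N r ω) (Set.Ici t) t
  indepIncrements : HasIndepIncrements (fun t ω => (N t ω : ℝ)) P
  law_increment : ∀ s h : ℝ≥0, HasLaw (fun ω => (N (s + h) ω : ℝ) - (N s ω : ℝ))
    ((poissonMeasure (lam * h)).map (fun n : ℕ => (n : ℝ))) P

/-- `Z` is a compound Poisson process with intensity `lam` and jump law `ν`: almost surely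
`Z t = J₁ + ⋯ + J_{N t}` for all `t`, where `N` is a Poisson process with intensity `lam`, the
jumps are independent with law `ν`, and the jumps are independent of `N`. -/
def IsCompoundPoissonProcess {Ω : Type*} [MeasurableSpace Ω] (lam : ℝ≥0) (ν : Measure ℝ)
    (Z : ℝ≥0 → Ω → ℝ) (P : Measure Ω) : Prop :=
  ∃ (N : ℝ≥0 → Ω → ℕ) (J : ℕ → Ω → ℝ),
    IsPoissonProcess lam N P ∧
    (∀ n, Measurable (J n)) ∧ (∀ n, HasLaw (J n) ν P) ∧ iIndepFun J P ∧
    IndepFun (fun ω t => N t ω) (fun ω n => J n ω) P ∧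
    ∀ᵐ ω ∂P, ∀ t, Z t ω = ∑ n ∈ Finset.range (N t ω), J n ω

/-- `X` solves `dX(t) = -k X(t) dt + dZ(t)` with initial value `X 0`, that is, almost surely
`X(t) = X(0) - k ∫₀ᵗ X(r) dr + Z(t)` for all `t ≥ 0`, where the path of `X` is integrable on
bounded time intervals and `Z` is a driving process with `Z(0) = 0`. -/
structure SolvesOU {Ω : Type*} [MeasurableSpace Ω] (k : ℝ) (Z X : ℝ≥0 → Ω → ℝ)
    (P : Measure Ω) : Prop where
  measurable : ∀ t, Measurable (X t)
  integrable : ∀ᵐ ω ∂P, ∀ t : ℝ≥0,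
    IntervalIntegrable (fun r : ℝ => X r.toNNReal ω) volume 0 (t : ℝ)
  equation : ∀ᵐ ω ∂P, ∀ t : ℝ≥0,
    X t ω = X 0 ω - k * (∫ r in (0 : ℝ)..(t : ℝ), X r.toNNReal ω) + Z t ω

/-- `X` is a symmetric bilateral-gamma Ornstein-Uhlenbeck process with parameters `k`, `lam`, `β`:
it solves `dX = -k X dt + dZ`, where the driving process `Z` is compound Poisson with intensity
`lam` and centered Laplace jumps with rate `β`, and is independent of the initial value. -/
def IsSymmetricBGammaOU {Ω : Type*} [MeasurableSpace Ω] (k : ℝ) (lam : ℝ≥0) (β : ℝ)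
    (X : ℝ≥0 → Ω → ℝ) (P : Measure Ω) : Prop :=
  ∃ Z : ℝ≥0 → Ω → ℝ,
    IsCompoundPoissonProcess lam (laplaceMeasure β) Z P ∧
    IndepFun (X 0) (fun ω t => Z t ω) P ∧
    SolvesOU k Z X P

/-- `φ(u) = ∫₀¹ β² e^{2 k t v} / (β² e^{2 k t v} + u²) dv`. -/
noncomputable def phiL (β k t u : ℝ) : ℝ :=
  ∫ v in (0 : ℝ)..1,
    β ^ 2 * Real.exp (2 * k * t * v) / (β ^ 2 * Real.exp (2 * k * t * v) + u ^ 2)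

/-! By variation of constants, `X (s + t) - e ^ (-k t) X s` is the integral of `e ^ (-k (s + t -
r))` against `Z` over the time interval from `s` to `s + t`. A jump at remaining time `t v` is
damped by `e ^ (-k t v)`. A Laplace variable of rate `β` so damped is Laplace of rate `β e ^ (k t
v)`, and the jump times of a Poisson process are uniform, so the mixture law appears. Independence
from `X s` comes from the independent increments of `Z` and its independence of `X 0`.

The proof needs no stochastic integral and no jump times. Pathwise, the integral is a limit of sums
of increments of `Z` over uniform grids (`tendsto_stieltjesSum_of_linear_equation`). For such finite
sums the joint characteristic function with the past factors exactly
(`IsCompoundPoissonProcess.integral_exp_initial_add_grid_increments`). Bounded convergence carries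
the factorization to the limit (`SolvesOU.integral_exp_increment`), where the product of
exponentials becomes the exponential of an integral. For Laplace jumps,
`integral_charFun_laplaceMeasure` evaluates that integral as `t * (phiL β k t u - 1)`. Uniqueness of
characteristic functions then gives the law and the independence, and the conditional formula
follows. -/

/-! ### Characteristic functions of the Laplace, mixture and compound Poisson laws -/

theorem integral_pow_poissonMeasure (r : ℝ≥0) (z : ℂ) :
    ∫ n, z ^ n ∂(poissonMeasure r) = Complex.exp (r * (z - 1)) := by
  rw [integral_poissonMeasure]
  have h : ∀ n : ℕ, (Real.exp (-r) * r ^ n / (n.factorial : ℝ)) • z ^ n =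
      (Complex.exp (-r)) * ((r * z) ^ n / (n.factorial : ℂ)) := fun n => by
    rw [Complex.real_smul]
    push_cast
    ring
  simp_rw [h]
  rw [tsum_mul_left, (NormedSpace.expSeries_div_hasSum_exp ((r : ℂ) * z)).tsum_eq,
    ← Complex.exp_eq_exp_ℂ, ← Complex.exp_add]
  ring_nf

theorem laplacePDF_mul_exp_of_nonpos (β u : ℝ) {x : ℝ} (hx : x ≤ 0) :
    ((β / 2 * Real.exp (-(β * |x|)) : ℝ) : ℂ) * Complex.exp (u * x * Complex.I) =
      β / 2 * Complex.exp ((β + u * Complex.I) * x) := by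
  rw [abs_of_nonpos hx]
  push_cast
  rw [mul_assoc, ← Complex.exp_add]
  ring_nf

theorem laplacePDF_mul_exp_of_pos (β u : ℝ) {x : ℝ} (hx : 0 < x) :
    ((β / 2 * Real.exp (-(β * |x|)) : ℝ) : ℂ) * Complex.exp (u * x * Complex.I) =
      β / 2 * Complex.exp ((-β + u * Complex.I) * x) := by
  rw [abs_of_pos hx]
  push_cast
  rw [mul_assoc, ← Complex.exp_add]
  ring_nf

theorem charFun_laplaceMeasure {β : ℝ} (hβ : 0 < β) (u : ℝ) :
    charFun (laplaceMeasure β) u = (β ^ 2 / (β ^ 2 + u ^ 2) : ℝ) := by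
  have h1 : 0 < (β + u * Complex.I : ℂ).re := by simpa using hβ
  have h2 : (-β + u * Complex.I : ℂ).re < 0 := by simpa using hβ
  have hm : Measurable (laplacePDF β) := by unfold laplacePDF; fun_prop
  have hI : ∀ x : ℝ, (laplacePDF β x).toReal • Complex.exp (u * x * Complex.I) =
      ((β / 2 * Real.exp (-(β * |x|)) : ℝ) : ℂ) * Complex.exp (u * x * Complex.I) := fun x => by
    rw [laplacePDF, ENNReal.toReal_ofReal (by positivity), Complex.real_smul]
  rw [charFun_apply_real, laplaceMeasure, integral_withDensity_eq_integral_toReal_smul hm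
    (Filter.Eventually.of_forall fun x => ENNReal.ofReal_lt_top)]
  simp_rw [hI]
  have i1 : IntegrableOn (fun x : ℝ => ((β / 2 * Real.exp (-(β * |x|)) : ℝ) : ℂ) *
      Complex.exp (u * x * Complex.I)) (Set.Iic 0) :=
    IntegrableOn.congr_fun ((integrableOn_exp_mul_complex_Iic h1 0).const_mul (β / 2 : ℂ))
      (fun x hx => (laplacePDF_mul_exp_of_nonpos β u hx).symm) measurableSet_Iic
  have i2 : IntegrableOn (fun x : ℝ => ((β / 2 * Real.exp (-(β * |x|)) : ℝ) : ℂ) *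
      Complex.exp (u * x * Complex.I)) (Set.Ioi 0) :=
    IntegrableOn.congr_fun ((integrableOn_exp_mul_complex_Ioi h2 0).const_mul (β / 2 : ℂ))
      (fun x hx => (laplacePDF_mul_exp_of_pos β u hx).symm) measurableSet_Ioi
  rw [← setIntegral_univ, ← Set.Iic_union_Ioi (a := (0 : ℝ)),
    setIntegral_union (Set.Iic_disjoint_Ioi le_rfl) measurableSet_Ioi i1 i2,
    setIntegral_congr_fun measurableSet_Iic (fun x hx => laplacePDF_mul_exp_of_nonpos β u hx),
    setIntegral_congr_fun measurableSet_Ioi (fun x hx => laplacePDF_mul_exp_of_pos β u hx),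
    integral_const_mul, integral_const_mul, integral_exp_mul_complex_Iic h1,
    integral_exp_mul_complex_Ioi h2]
  have n1 : (β + u * Complex.I : ℂ) ≠ 0 := fun h => by simp [h] at h1
  have n2 : (-β + u * Complex.I : ℂ) ≠ 0 := fun h => by simp [h] at h2
  have n3 : (β ^ 2 + u ^ 2 : ℂ) ≠ 0 := by
    have : (β ^ 2 + u ^ 2 : ℂ) = ((β ^ 2 + u ^ 2 : ℝ) : ℂ) := by push_cast; rfl
    rw [this, Complex.ofReal_ne_zero]
    positivity
  -- The two half-lines contribute `β / 2` times `1 / (β + iu)` and `-1 / (-β + iu)`; this is their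
  -- common denominator up to sign.
  have hprod : (β ^ 2 + u ^ 2 : ℂ) = -((β + u * Complex.I) * (-β + u * Complex.I)) := by
    linear_combination (u : ℂ) ^ 2 * Complex.I_sq
  push_cast
  rw [hprod]
  simp only [mul_zero, Complex.exp_zero]
  field_simp
  ring

theorem isProbabilityMeasure_laplaceMeasure {β : ℝ} (hβ : 0 < β) :
    IsProbabilityMeasure (laplaceMeasure β) := by
  have h := charFun_laplaceMeasure hβ 0
  have hβ' : (β : ℂ) ≠ 0 := by exact_mod_cast hβ.ne'
  rw [charFun_zero] at h
  constructor
  -- The total mass is the characteristic function at `0`. A real mass of `1` also rules out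
  -- infinite mass, which would read as `0`.
  have h' : (laplaceMeasure β).real Set.univ = 1 := by
    rw [← Complex.ofReal_inj, h]
    simp [hβ']
  rwa [measureReal_def, ENNReal.toReal_eq_one_iff] at h'

theorem measurable_laplaceMeasure_mul_exp (β c : ℝ) :
    Measurable fun v : ℝ => laplaceMeasure (β * Real.exp (c * v)) :=
  measurable_laplaceMeasure.comp (by fun_prop)

theorem integrable_exp_mul_I (μ : Measure ℝ) [IsFiniteMeasure μ] (u : ℝ) :
    Integrable (fun x : ℝ => Complex.exp (u * x * Complex.I)) μ := by
  refine .of_bound (by fun_prop) 1 (.of_forall fun x => ?_)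
  rw [← Complex.ofReal_mul, Complex.norm_exp_ofReal_mul_I]

theorem isProbabilityMeasure_laplaceMixture {β : ℝ} (hβ : 0 < β) (c : ℝ) :
    IsProbabilityMeasure (laplaceMixture β c) := by
  constructor
  rw [laplaceMixture, Measure.bind_apply .univ (measurable_laplaceMeasure_mul_exp β c).aemeasurable]
  have (v : ℝ) : laplaceMeasure (β * Real.exp (c * v)) Set.univ = 1 :=
    (isProbabilityMeasure_laplaceMeasure (by positivity)).measure_univ
  simp [this]

theorem charFun_laplaceMixture {β : ℝ} (hβ : 0 < β) (k t u : ℝ) :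
    charFun (laplaceMixture β (k * t)) u = phiL β k t u := by
  -- Viewing the mixture as a composition of kernels lets the integral be taken first over the
  -- Laplace law with `v` fixed, then over `v`.
  let κ : Kernel ℝ ℝ := ⟨_, measurable_laplaceMeasure_mul_exp β (k * t)⟩
  have hκ : laplaceMixture β (k * t) =
      (κ ∘ₖ Kernel.const Unit (volume.restrict (Set.Icc (0 : ℝ) 1))) () := by
    rw [Kernel.comp_apply]
    rfl
  have := isProbabilityMeasure_laplaceMixture hβ (k * t)
  rw [charFun_apply_real, hκ, Kernel.integral_comp (hκ ▸ integrable_exp_mul_I _ u), phiL,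
    Kernel.const_apply, integral_Icc_eq_integral_Ioc,
    intervalIntegral.integral_of_le zero_le_one, ← integral_complex_ofReal]
  congr 1 with v
  change ∫ y, _ ∂(laplaceMeasure (β * Real.exp (k * t * v))) = _
  rw [← charFun_apply_real, charFun_laplaceMeasure (by positivity), mul_pow, ← Real.exp_nat_mul]
  push_cast
  ring_nf

theorem isProbabilityMeasure_convPower (ν : Measure ℝ) [IsProbabilityMeasure ν] (n : ℕ) :
    IsProbabilityMeasure (convPower ν n) := by
  induction n with
  | zero => exact Measure.dirac.isProbabilityMeasure
  | succ n ih => rw [convPower]; infer_instance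

theorem charFun_convPower (ν : Measure ℝ) [IsProbabilityMeasure ν] (n : ℕ) (u : ℝ) :
    charFun (convPower ν n) u = charFun ν u ^ n := by
  induction n with
  | zero => simp [convPower, charFun_dirac]
  | succ n ih =>
    have := isProbabilityMeasure_convPower ν n
    rw [convPower, charFun_conv, ih, pow_succ]

theorem isProbabilityMeasure_compoundPoissonMeasure (r : ℝ≥0) (ν : Measure ℝ)
    [IsProbabilityMeasure ν] : IsProbabilityMeasure (compoundPoissonMeasure r ν) := by
  constructor
  have h (n : ℕ) : convPower ν n Set.univ = 1 :=
    (isProbabilityMeasure_convPower ν n).measure_univ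
  simp only [compoundPoissonMeasure, Measure.sum_apply _ MeasurableSet.univ,
    Measure.smul_apply, h, smul_eq_mul, mul_one]
  rw [← measure_iUnion (fun i j hij => by simpa using hij) (fun _ => measurableSet_singleton _),
    Set.iUnion_of_singleton, measure_univ]

/-- Given `M = n` the characteristic function is the `n`-th power of that of `ν`, so averaging over
`M` evaluates the Poisson generating function at `charFun ν u`. -/
theorem charFun_compoundPoissonMeasure (r : ℝ≥0) (ν : Measure ℝ) [IsProbabilityMeasure ν] (u : ℝ) :
    charFun (compoundPoissonMeasure r ν) u = Complex.exp (r * (charFun ν u - 1)) := by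
  have := isProbabilityMeasure_compoundPoissonMeasure r ν
  have hi := integrable_exp_mul_I (compoundPoissonMeasure r ν) u
  rw [← integral_pow_poissonMeasure, integral_poissonMeasure, charFun_apply_real]
  rw [compoundPoissonMeasure] at hi ⊢
  rw [integral_sum_measure hi]
  congr 1 with n
  rw [integral_smul_measure, ← charFun_apply_real, charFun_convPower, ← measureReal_def,
    poissonMeasure_real_singleton]

/-! ### Riemann sums and the pathwise linear equation -/

open Filter Topology in
/-- Riemann-type sums converge when the integrand, evaluated at the two ends of the cell of the
uniform grid that contains `r`, converges as both ends tend to `r`. -/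
theorem tendsto_sum_integral_uniformGrid {E : Type*} [NormedAddCommGroup E] [NormedSpace ℝ E]
    {a b : ℝ} (hab : a < b) {F : ℝ → ℝ → ℝ → E} {G : ℝ → E} {B : ℝ → ℝ}
    (hmeas : ∀ l m, AEStronglyMeasurable (F l m) (volume.restrict (Set.Ioo a b)))
    (hB : IntervalIntegrable B volume a b)
    (hbound : ∀ l ∈ Set.Icc a b, ∀ m ∈ Set.Icc a b, ∀ r ∈ Set.Ico a b, ‖F l m r‖ ≤ B r)
    (hlim : ∀ r ∈ Set.Ico a b, Tendsto (fun p : ℝ × ℝ => F p.1 p.2 r)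
      (𝓝[Set.Icc a r] r ×ˢ 𝓝[Set.Icc r b] r) (𝓝 (G r))) :
    Tendsto (fun n : ℕ => ∑ j ∈ Finset.range n,
      ∫ r in (a + j * ((b - a) / n))..(a + (j + 1 : ℕ) * ((b - a) / n)),
        F (a + j * ((b - a) / n)) (a + (j + 1 : ℕ) * ((b - a) / n)) r) atTop
      (𝓝 (∫ r in a..b, G r)) := by
  -- `q n r` is the index of the half-open cell containing `r`. With it the whole sum is one
  -- integral of `H n` over the interval, and dominated convergence applies.
  let q : ℕ → ℝ → ℕ := fun n r => ⌊(r - a) / ((b - a) / n)⌋₊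
  let τ : ℕ → ℕ → ℝ := fun n j => a + j * ((b - a) / n)
  let H : ℕ → ℝ → E := fun n r => F (τ n (q n r)) (τ n (q n r + 1)) r
  have hpos : ∀ {n : ℕ}, 0 < n → 0 < (b - a) / n := fun {n} hn => by
    have : (0 : ℝ) < n := by exact_mod_cast hn
    have := sub_pos.2 hab
    positivity
  have hq : ∀ {n : ℕ}, 0 < n → ∀ {j : ℕ} {r : ℝ}, r ∈ Set.Ico (τ n j) (τ n (j + 1)) →
      q n r = j := fun {n} hn {j r} hr => by
    have h0 := hpos hn
    obtain ⟨h1, h2⟩ := hr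
    simp only [τ] at h1 h2
    push_cast at h2
    have hnn : 0 ≤ (r - a) / ((b - a) / n) := by
      refine div_nonneg ?_ h0.le
      have : 0 ≤ (j : ℝ) * ((b - a) / n) := by positivity
      linarith
    refine (Nat.floor_eq_iff hnn).2 ⟨?_, ?_⟩
    · rw [le_div_iff₀ h0]; linarith
    · rw [div_lt_iff₀ h0]; linarith
  have hτ0 : ∀ n, τ n 0 = a := fun n => by simp [τ]
  have hτn : ∀ {n : ℕ}, 0 < n → τ n n = b := fun {n} hn => by
    have : (n : ℝ) ≠ 0 := by exact_mod_cast hn.ne'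
    simp only [τ]
    field_simp
    ring
  have hτmono : ∀ {n : ℕ}, 0 < n → Monotone (τ n) := fun {n} hn i j hij => by
    have h0 := hpos hn
    have : (i : ℝ) ≤ j := by exact_mod_cast hij
    simp only [τ]
    gcongr
  have hcell : ∀ {n : ℕ}, 0 < n → ∀ {r : ℝ}, r ∈ Set.Ico a b →
      q n r < n ∧ τ n (q n r) ≤ r ∧ r < τ n (q n r + 1) := fun {n} hn {r} hr => by
    have h0 := hpos hn
    have hn' : (0 : ℝ) < n := by exact_mod_cast hn
    have hnn : 0 ≤ (r - a) / ((b - a) / n) := div_nonneg (sub_nonneg.2 hr.1) h0.le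
    have h1 := Nat.floor_le hnn
    have h2 := Nat.lt_floor_add_one ((r - a) / ((b - a) / n))
    rw [le_div_iff₀ h0] at h1
    rw [div_lt_iff₀ h0] at h2
    refine ⟨(Nat.floor_lt hnn).2 ?_, ?_, ?_⟩
    · rw [div_lt_iff₀ h0, mul_div_cancel₀ _ hn'.ne']
      linarith [hr.2]
    · simp only [τ, q]; linarith
    · simp only [τ, q]; push_cast; linarith
  have hmem : ∀ {n : ℕ}, 0 < n → ∀ {j : ℕ}, j ≤ n → τ n j ∈ Set.Icc a b := fun {n} hn {j} hj =>
    ⟨hτ0 n ▸ hτmono hn (Nat.zero_le j), hτn hn ▸ hτmono hn hj⟩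
  have hqm : ∀ n, Measurable (q n) := fun n => by
    simp only [q]
    exact Nat.measurable_floor.comp (by fun_prop)
  have hHmeas : ∀ n, AEStronglyMeasurable (H n) (volume.restrict (Set.Ioo a b)) := fun n => by
    -- On each of the countably many level sets of `q n`, `H n` is `F` with fixed endpoints, hence
    -- measurable there.
    have hcov : (⋃ j : ℕ, q n ⁻¹' {j} ∩ Set.Ioo a b) = Set.Ioo a b := by
      rw [← Set.iUnion_inter, ← Set.preimage_iUnion, Set.iUnion_of_singleton, Set.preimage_univ,
        Set.univ_inter]
    rw [← hcov, aestronglyMeasurable_iUnion_iff]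
    refine fun j => ((hmeas (τ n j) (τ n (j + 1))).mono_measure
      (Measure.restrict_mono_set _ Set.inter_subset_right)).congr ?_
    filter_upwards [ae_restrict_mem ((hqm n (measurableSet_singleton j)).inter measurableSet_Ioo)]
      with r hr
    have hj : q n r = j := hr.1
    simp only [H, hj]
  have hHbound : ∀ {n : ℕ}, 0 < n → ∀ {r : ℝ}, r ∈ Set.Ico a b → ‖H n r‖ ≤ B r :=
    fun {n} hn {r} hr => hbound _ (hmem hn (hcell hn hr).1.le) _ (hmem hn (hcell hn hr).1) _ hr
  have hHint : ∀ {n : ℕ}, 0 < n → IntervalIntegrable (H n) volume a b := fun {n} hn => by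
    rw [intervalIntegrable_iff_integrableOn_Ioo_of_le hab.le] at hB ⊢
    refine hB.mono' (hHmeas n) ?_
    filter_upwards [ae_restrict_mem measurableSet_Ioo] with r hr
    exact hHbound hn ⟨hr.1.le, hr.2⟩
  have hsum : ∀ {n : ℕ}, 0 < n → ∑ j ∈ Finset.range n,
      ∫ r in (τ n j)..(τ n (j + 1)), F (τ n j) (τ n (j + 1)) r = ∫ r in a..b, H n r :=
    fun {n} hn => by
    rw [← hτ0 n, ← hτn hn, ← intervalIntegral.sum_integral_adjacent_intervals]
    · refine Finset.sum_congr rfl fun j hj => ?_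
      -- The right end of a cell has index `j + 1`; passing to open cells discards it as a null set.
      rw [intervalIntegral.integral_of_le (hτmono hn j.le_succ),
        intervalIntegral.integral_of_le (hτmono hn j.le_succ),
        integral_Ioc_eq_integral_Ioo, integral_Ioc_eq_integral_Ioo]
      refine setIntegral_congr_fun measurableSet_Ioo fun r hr => ?_
      simp only [H, hq hn ⟨hr.1.le, hr.2⟩]
    · intro j hj
      refine (hHint hn).mono_set ?_
      rw [Set.uIcc_of_le hab.le, Set.uIcc_of_le (hτmono hn j.le_succ)]
      exact Set.Icc_subset_Icc (hmem hn hj.le).1 (hmem hn hj).2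
  have hlimH : Tendsto (fun n => ∫ r in a..b, H n r) atTop (𝓝 (∫ r in a..b, G r)) := by
    simp_rw [intervalIntegral.integral_of_le hab.le, integral_Ioc_eq_integral_Ioo]
    refine tendsto_integral_filter_of_dominated_convergence B ?_ ?_ ?_ ?_
    · filter_upwards [eventually_gt_atTop 0] with n hn using hHmeas n
    · filter_upwards [eventually_gt_atTop 0] with n hn
      filter_upwards [ae_restrict_mem measurableSet_Ioo] with r hr
      exact hHbound hn ⟨hr.1.le, hr.2⟩
    · exact (intervalIntegrable_iff_integrableOn_Ioo_of_le hab.le).1 hB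
    · filter_upwards [ae_restrict_mem measurableSet_Ioo] with r hr
      have hr' : r ∈ Set.Ico a b := ⟨hr.1.le, hr.2⟩
      have hh : Tendsto (fun n : ℕ => (b - a) / n) atTop (𝓝 0) :=
        tendsto_const_div_atTop_nhds_zero_nat (b - a)
      have hstep : ∀ n j, τ n (j + 1) = τ n j + (b - a) / n := fun n j => by
        simp only [τ]; push_cast; ring
      refine (hlim r hr').comp (Tendsto.prodMk ?_ ?_)
      · refine tendsto_nhdsWithin_iff.2 ⟨?_, ?_⟩
        · refine tendsto_of_tendsto_of_tendsto_of_le_of_le' (g := fun n : ℕ => r - (b - a) / n)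
            (h := fun _ => r) (by simpa using tendsto_const_nhds.sub hh) tendsto_const_nhds ?_ ?_
          · filter_upwards [eventually_gt_atTop 0] with n hn
            have := (hcell hn hr').2.2
            rw [hstep] at this
            linarith
          · filter_upwards [eventually_gt_atTop 0] with n hn using (hcell hn hr').2.1
        · filter_upwards [eventually_gt_atTop 0] with n hn
          exact ⟨(hmem hn (hcell hn hr').1.le).1, (hcell hn hr').2.1⟩
      · refine tendsto_nhdsWithin_iff.2 ⟨?_, ?_⟩
        · refine tendsto_of_tendsto_of_tendsto_of_le_of_le' (g := fun _ => r)
            (h := fun n : ℕ => r + (b - a) / n) tendsto_const_nhds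
            (by simpa using tendsto_const_nhds.add hh) ?_ ?_
          · filter_upwards [eventually_gt_atTop 0] with n hn using (hcell hn hr').2.2.le
          · filter_upwards [eventually_gt_atTop 0] with n hn
            refine (hstep n _).le.trans ?_
            linarith [(hcell hn hr').2.1]
        · filter_upwards [eventually_gt_atTop 0] with n hn
          exact ⟨(hcell hn hr').2.2.le, (hmem hn (hcell hn hr').1).2⟩
  refine hlimH.congr' ?_
  filter_upwards [eventually_gt_atTop 0] with n hn using (hsum hn).symm

open Filter Topology in
/-- Riemann sums of a continuous function over the uniform grid. -/
theorem tendsto_riemannSum_of_continuous {E : Type*} [NormedAddCommGroup E] [NormedSpace ℝ E]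
    [CompleteSpace E] {a b : ℝ} (hab : a ≤ b) {f : ℝ → E} (hf : Continuous f) :
    Tendsto (fun n : ℕ => ∑ j ∈ Finset.range n, ((b - a) / n) • f (a + j * ((b - a) / n))) atTop
      (𝓝 (∫ r in a..b, f r)) := by
  rcases hab.eq_or_lt with rfl | hab
  · simp
  obtain ⟨M, hM⟩ := isCompact_Icc.exists_bound_of_continuousOn (s := Set.Icc a b) hf.continuousOn
  have h := tendsto_sum_integral_uniformGrid hab (F := fun l _ _ => f l) (G := f) (B := fun _ => M)
    (fun _ _ => aestronglyMeasurable_const) intervalIntegrable_const (fun l hl _ _ _ _ => hM l hl)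
    (fun r _ => (hf.continuousAt.tendsto.mono_left nhdsWithin_le_nhds).comp tendsto_fst)
  refine h.congr fun n => Finset.sum_congr rfl fun j _ => ?_
  rw [intervalIntegral.integral_const]
  congr 1
  push_cast
  ring

open Filter Topology in
/-- If `x' = -k x + z'` in integrated form, with a right-continuous bounded `z`, then
`x b - e ^ (-k (b - a)) x a` is the limit of the Riemann-Stieltjes sums of `r ↦ e ^ (-k (b - r))`
against `z`. -/
theorem tendsto_stieltjesSum_of_linear_equation {k a b C M : ℝ} {x z : ℝ → ℝ} (hk : 0 ≤ k)
    (hab : a ≤ b) (hx : IntervalIntegrable x volume a b)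
    (heq : ∀ r ∈ Set.Icc a b, x r = C - k * (∫ v in a..r, x v) + z r)
    (hz : ∀ r ∈ Set.Ico a b, ContinuousWithinAt z (Set.Icc r b) r)
    (hM : ∀ r ∈ Set.Icc a b, |z r| ≤ M) :
    Tendsto (fun n : ℕ => ∑ j ∈ Finset.range n,
      Real.exp (-(k * (b - (a + j * ((b - a) / n))))) *
        (z (a + (j + 1 : ℕ) * ((b - a) / n)) - z (a + j * ((b - a) / n)))) atTop
      (𝓝 (x b - Real.exp (-(k * (b - a))) * x a)) := by
  rcases hab.eq_or_lt with rfl | hab'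
  · simp
  let c : ℝ → ℝ := fun r => Real.exp (-(k * (b - r)))
  have hc : Continuous c := by fun_prop
  have hcle : ∀ r ≤ b, |c r| ≤ 1 := fun r hr => by
    rw [abs_of_pos (Real.exp_pos _), Real.exp_le_one_iff]
    have := mul_nonneg hk (sub_nonneg.2 hr)
    linarith
  have hcd : ∀ r, HasDerivAt c (k * c r) r := fun r => by
    have h : HasDerivAt (fun r => -(k * (b - r))) k r := by
      simpa using (((hasDerivAt_id' r).const_sub b).const_mul k).fun_neg
    simpa [c, mul_comm] using h.exp
  have hsub : ∀ {l m : ℝ}, l ∈ Set.Icc a b → m ∈ Set.Icc a b → IntervalIntegrable x volume l m :=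
    fun {l m} hl hm => hx.mono_set (by
      rw [Set.uIcc_of_le hab]; exact Set.uIcc_subset_Icc hl hm)
  have hamem : a ∈ Set.Icc a b := ⟨le_rfl, hab⟩
  -- The equation transfers boundedness and right-continuity from `z` to `x`, since the primitive of
  -- `x` is continuous.
  have hY : ContinuousOn (fun r => ∫ v in a..r, x v) (Set.Icc a b) := by
    have := intervalIntegral.continuousOn_primitive_interval' hx Set.left_mem_uIcc
    rwa [Set.uIcc_of_le hab] at this
  obtain ⟨K, hK⟩ := isCompact_Icc.exists_bound_of_continuousOn hY
  let B := |C| + k * K + M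
  have hxB : ∀ r ∈ Set.Icc a b, |x r| ≤ B := fun r hr => by
    rw [heq r hr]
    refine (abs_add_le _ _).trans (add_le_add ((abs_sub _ _).trans (add_le_add le_rfl ?_)) (hM r hr))
    rw [abs_mul, abs_of_nonneg hk]
    exact mul_le_mul_of_nonneg_left (hK r hr) hk
  have hxr : ∀ r ∈ Set.Ico a b, ContinuousWithinAt x (Set.Icc r b) r := fun r hr => by
    have hs : Set.Icc r b ⊆ Set.Icc a b := Set.Icc_subset_Icc_left hr.1
    refine ContinuousWithinAt.congr (f := fun r => C - k * (∫ v in a..r, x v) + z r) ?_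
      (fun y hy => heq y (hs hy)) (heq r ⟨hr.1, hr.2.le⟩)
    exact (continuousWithinAt_const.sub (continuousWithinAt_const.mul
      ((hY r ⟨hr.1, hr.2.le⟩).mono hs))).add (hz r hr)
  -- Summation by parts with `c' = k c`: on a cell from `l` to `m`, `c l * (z m - z l)` equals the
  -- increment of `c * x` plus the integral of this `F l m`. The first part telescopes and the
  -- second vanishes in the limit. Right-continuity of `x` suffices because `x` is sampled at the
  -- right end `m` only.
  have hlim := tendsto_sum_integral_uniformGrid hab'
    (F := fun l m r => k * c l * x r - k * c r * x m) (G := fun _ => 0)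
    (B := fun r => k * |x r| + k * B)
    (fun l m => ((((intervalIntegrable_iff_integrableOn_Ioo_of_le hab).1 hx).const_mul
      (k * c l)).aestronglyMeasurable).sub (by fun_prop))
    ((hx.abs.const_mul k).add intervalIntegrable_const)
    (fun l hl m hm r hr => by
      refine (abs_sub _ _).trans (add_le_add ?_ ?_)
      · rw [abs_mul, abs_mul, abs_of_nonneg hk, mul_assoc]
        gcongr
        exact mul_le_of_le_one_left (abs_nonneg _) (hcle l hl.2)
      · rw [abs_mul, abs_mul, abs_of_nonneg hk, mul_assoc]
        gcongr
        exact (mul_le_of_le_one_left (abs_nonneg _) (hcle r hr.2.le)).trans (hxB m hm))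
    (fun r hr => by
      have h1 : Tendsto (fun p : ℝ × ℝ => c p.1) (𝓝[Set.Icc a r] r ×ˢ 𝓝[Set.Icc r b] r)
          (𝓝 (c r)) :=
        (hc.continuousAt.tendsto.mono_left nhdsWithin_le_nhds).comp tendsto_fst
      have h2 : Tendsto (fun p : ℝ × ℝ => x p.2) (𝓝[Set.Icc a r] r ×ˢ 𝓝[Set.Icc r b] r)
          (𝓝 (x r)) := (hxr r hr).tendsto.comp tendsto_snd
      have := ((h1.const_mul k).mul_const (x r)).sub (h2.const_mul (k * c r))
      simpa using this)
  rw [intervalIntegral.integral_zero] at hlim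
  have hlim' := hlim.add_const (x b - Real.exp (-(k * (b - a))) * x a)
  rw [zero_add] at hlim'
  refine hlim'.congr' ?_
  filter_upwards [eventually_gt_atTop 0] with n hn
  let τ : ℕ → ℝ := fun j => a + j * ((b - a) / n)
  have hn' : (0 : ℝ) < n := by exact_mod_cast hn
  have hd : 0 < (b - a) / n := div_pos (sub_pos.2 hab') hn'
  have hτ0 : τ 0 = a := by simp [τ]
  have hτn : τ n = b := by
    simp only [τ]
    field_simp
    ring
  have hτmono : Monotone τ := fun i j hij => by
    have : (i : ℝ) ≤ j := by exact_mod_cast hij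
    simp only [τ]
    gcongr
  have hmem : ∀ {j : ℕ}, j ≤ n → τ j ∈ Set.Icc a b := fun {j} hj =>
    ⟨hτ0 ▸ hτmono (Nat.zero_le j), hτn ▸ hτmono hj⟩
  have htel : x b - Real.exp (-(k * (b - a))) * x a =
      ∑ j ∈ Finset.range n, (c (τ (j + 1)) * x (τ (j + 1)) - c (τ j) * x (τ j)) := by
    rw [Finset.sum_range_sub (fun j => c (τ j) * x (τ j)), hτ0, hτn]
    simp [c]
  rw [htel, ← Finset.sum_add_distrib]
  refine Finset.sum_congr rfl fun j hj => ?_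
  have hj0 := hmem (Finset.mem_range.1 hj).le
  have hj1 : τ (j + 1) ∈ Set.Icc a b := hmem (Finset.mem_range.1 hj)
  change (∫ r in (τ j)..(τ (j + 1)), (k * c (τ j) * x r - k * c r * x (τ (j + 1)))) +
    (c (τ (j + 1)) * x (τ (j + 1)) - c (τ j) * x (τ j)) = c (τ j) * (z (τ (j + 1)) - z (τ j))
  rw [intervalIntegral.integral_sub ((hsub hj0 hj1).const_mul _)
      (Continuous.intervalIntegrable (by fun_prop) _ _),
    intervalIntegral.integral_const_mul, intervalIntegral.integral_mul_const,
    intervalIntegral.integral_eq_sub_of_hasDerivAt (f := c) (fun r _ => hcd r)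
      (Continuous.intervalIntegrable (by fun_prop) _ _)]
  have e0 := heq _ hj0
  have e1 := heq _ hj1
  rw [← intervalIntegral.integral_add_adjacent_intervals (hsub hamem hj0) (hsub hj0 hj1)] at e1
  linear_combination c (τ j) * e1 - c (τ j) * e0

/-! ### Joint characteristic functions of compound Poisson increments -/

theorem ProbabilityTheory.IndepFun.integral_comp_prodMk {Ω α β : Type*} [MeasurableSpace Ω]
    [MeasurableSpace α] [MeasurableSpace β] {P : Measure Ω} [IsProbabilityMeasure P]
    {f : Ω → α} {g : Ω → β} (h : IndepFun f g P) (hf : Measurable f) (hg : Measurable g)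
    {F : α × β → ℂ} (hF : Measurable F) {C : ℝ} (hC : ∀ p, ‖F p‖ ≤ C) :
    ∫ ω, F (f ω, g ω) ∂P = ∫ ω, ∫ ω', F (f ω, g ω') ∂P ∂P := by
  have := Measure.isProbabilityMeasure_map (μ := P) hf.aemeasurable
  have := Measure.isProbabilityMeasure_map (μ := P) hg.aemeasurable
  have hI : Integrable F ((P.map f).prod (P.map g)) :=
    .of_bound hF.aestronglyMeasurable C (.of_forall hC)
  rw [← integral_map (φ := fun ω => (f ω, g ω)) (hf.prodMk hg).aemeasurable
      hF.aestronglyMeasurable,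
    (indepFun_iff_map_prod_eq_prod_map_map hf.aemeasurable hg.aemeasurable).1 h,
    integral_prod _ hI, integral_map hf.aemeasurable hI.integral_prod_left.aestronglyMeasurable]
  congr 1 with ω
  exact integral_map hg.aemeasurable (hF.comp measurable_prodMk_left).aestronglyMeasurable

/-- For frozen counts `v j`, the jumps with index in `[v j, v (j + 1))` all get the weight `c j`.
Grouping equal weights turns a product over jumps into powers whose exponents are the increments of
the count. -/
theorem exists_weights_sum_increments {g : ℝ → ℂ} (c : ℕ → ℝ) {v : ℕ → ℕ} (hv : Monotone v)
    (n : ℕ) : ∃ w : ℕ → ℝ,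
      (∀ y : ℕ → ℝ, ∑ j ∈ Finset.range n,
        c j * (∑ m ∈ Finset.range (v (j + 1)), y m - ∑ m ∈ Finset.range (v j), y m) =
          ∑ m ∈ Finset.Ico (v 0) (v n), w m * y m) ∧
      ∏ m ∈ Finset.Ico (v 0) (v n), g (w m) =
        ∏ j ∈ Finset.range n, g (c j) ^ (v (j + 1) - v j) := by
  induction n with
  | zero => exact ⟨0, by simp⟩
  | succ n ih =>
    obtain ⟨w, hw1, hw2⟩ := ih
    have h0 := hv n.zero_le
    have h1 := hv n.le_succ
    have hl : ∀ m ∈ Finset.Ico (v 0) (v n), (if m < v n then w m else c n) = w m :=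
      fun m hm => if_pos (Finset.mem_Ico.1 hm).2
    have hr : ∀ m ∈ Finset.Ico (v n) (v (n + 1)), (if m < v n then w m else c n) = c n :=
      fun m hm => if_neg (Finset.mem_Ico.1 hm).1.not_gt
    refine ⟨fun m => if m < v n then w m else c n, fun y => ?_, ?_⟩
    · rw [Finset.sum_range_succ, hw1, ← Finset.sum_Ico_consecutive _ h0 h1,
        ← Finset.sum_Ico_eq_sub _ h1, Finset.mul_sum]
      congr 1
      · exact Finset.sum_congr rfl fun m hm => by simp only [hl m hm]
      · exact Finset.sum_congr rfl fun m hm => by simp only [hr m hm]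
    · rw [Finset.prod_range_succ, ← hw2, ← Finset.prod_Ico_consecutive _ h0 h1]
      congr 1
      · exact Finset.prod_congr rfl fun m hm => by simp only [hl m hm]
      · rw [← Nat.card_Ico, ← Finset.prod_const]
        exact Finset.prod_congr rfl fun m hm => by simp only [hr m hm]

section

variable {Ω : Type*} [MeasurableSpace Ω] {P : Measure Ω} {ν : Measure ℝ}

theorem integral_exp_sum_iIndepFun {J : ℕ → Ω → ℝ} (hm : ∀ n, Measurable (J n))
    (hlaw : ∀ n, HasLaw (J n) ν P) (hindep : iIndepFun J P) (s : Finset ℕ) (w : ℕ → ℝ) :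
    ∫ ω, Complex.exp ((∑ m ∈ s, w m * J m ω : ℝ) * Complex.I) ∂P =
      ∏ m ∈ s, charFun ν (w m) := by
  have h : ∀ ω, Complex.exp ((∑ m ∈ s, w m * J m ω : ℝ) * Complex.I) =
      ∏ m : s, (fun x : ℝ => Complex.exp (w m * x * Complex.I)) (J m ω) := fun ω => by
    rw [Finset.prod_coe_sort s (fun m => Complex.exp (w m * J m ω * Complex.I)),
      ← Complex.exp_sum, ← Finset.sum_mul]
    push_cast
    rfl
  simp_rw [h]
  have hs := hindep.precomp (g := fun m : s => (m : ℕ)) Subtype.val_injective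
  rw [hs.integral_fun_prod_comp (f := fun (m : s) (x : ℝ) => Complex.exp (w m * x * Complex.I))
    (fun m => (hm m).aemeasurable)
    (fun m => by fun_prop), ← Finset.prod_coe_sort s]
  refine Finset.prod_congr rfl fun m _ => ?_
  rw [charFun_apply_real, ← (hlaw m).map_eq, integral_map (hm m).aemeasurable (by fun_prop)]

theorem IsPoissonProcess.integral_prod_pow {lam : ℝ≥0} {N : ℝ≥0 → Ω → ℕ}
    (hN : IsPoissonProcess lam N P) {τ : ℕ → ℝ≥0} (hτ : Monotone τ) (z : ℕ → ℂ) (n : ℕ) :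
    ∫ ω, ∏ j ∈ Finset.range n, z j ^ (N (τ (j + 1)) ω - N (τ j) ω) ∂P =
      ∏ j ∈ Finset.range n,
        Complex.exp (lam * ((τ (j + 1) : ℝ) - τ j : ℝ) * (z j - 1)) := by
  have hm : ∀ j, Measurable fun ω => (N (τ (j + 1)) ω : ℝ) - (N (τ j) ω : ℝ) := fun j =>
    (measurable_from_nat.comp (hN.measurable _)).sub (measurable_from_nat.comp (hN.measurable _))
  have hf : ∀ j, Measurable fun x : ℝ => z j ^ ⌊x⌋₊ := fun j =>
    measurable_from_nat.comp Nat.measurable_floor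
  -- Independence and law are given for real-valued increments; the floor recovers the natural
  -- difference, truncation included.
  have hfl : ∀ a b : ℕ, ⌊(a : ℝ) - b⌋₊ = a - b := fun a b => by
    rw [Nat.floor_sub_natCast, Nat.floor_natCast]
  have h : ∀ ω, ∏ j ∈ Finset.range n, z j ^ (N (τ (j + 1)) ω - N (τ j) ω) =
      ∏ j : Fin n, (fun x : ℝ => z j ^ ⌊x⌋₊) ((N (τ (j + 1)) ω : ℝ) - N (τ j) ω) := fun ω => by
    simp only [hfl]
    exact Finset.prod_range _
  simp_rw [h]
  have hi := (hN.indepIncrements.nat hτ).precomp (g := fun j : Fin n => (j : ℕ)) Fin.val_injective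
  rw [hi.integral_fun_prod_comp (f := fun (j : Fin n) x => z j ^ ⌊x⌋₊)
    (fun j => (hm j).aemeasurable) (fun j => (hf j).aestronglyMeasurable), Finset.prod_range]
  refine Finset.prod_congr rfl fun j _ => ?_
  have hle : τ j ≤ τ (j + 1) := hτ (Nat.le_succ _)
  have hlaw := hN.law_increment (τ j) (τ (j + 1) - τ j)
  rw [add_tsub_cancel_of_le hle] at hlaw
  rw [← integral_map (f := fun x : ℝ => z j ^ ⌊x⌋₊) (hm j).aemeasurable
      (hf j).aestronglyMeasurable, hlaw.map_eq,
    integral_map (Measurable.of_discrete).aemeasurable (hf j).aestronglyMeasurable]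
  simp_rw [Nat.floor_natCast]
  rw [integral_pow_poissonMeasure]
  push_cast [NNReal.coe_sub hle]
  rfl

/-- The joint characteristic function of the increments of a compound Poisson process. -/
theorem IsCompoundPoissonProcess.integral_exp_sum_increments [IsProbabilityMeasure P]
    [IsProbabilityMeasure ν] {lam : ℝ≥0} {Z : ℝ≥0 → Ω → ℝ}
    (hZ : IsCompoundPoissonProcess lam ν Z P) {τ : ℕ → ℝ≥0} (hτ : Monotone τ) (c : ℕ → ℝ) (n : ℕ) :
    ∫ ω, Complex.exp ((∑ j ∈ Finset.range n, c j * (Z (τ (j + 1)) ω - Z (τ j) ω) : ℝ) *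
        Complex.I) ∂P =
      ∏ j ∈ Finset.range n,
        Complex.exp (lam * ((τ (j + 1) : ℝ) - τ j : ℝ) * (charFun ν (c j) - 1)) := by
  obtain ⟨N, J, hN, hJm, hJlaw, hJ, hNJ, hZeq⟩ := hZ
  let S : ℕ × (ℕ → ℝ) → ℝ := fun p => ∑ m ∈ Finset.range p.1, p.2 m
  have hS : Measurable S := measurable_from_prod_countable_right fun m => by
    simp only [S]; fun_prop
  let F : (ℕ → ℕ) × (ℕ → ℝ) → ℂ := fun p => Complex.exp ((∑ j ∈ Finset.range n,
    c j * (S (p.1 (j + 1), p.2) - S (p.1 j, p.2)) : ℝ) * Complex.I)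
  have hSj : ∀ j, Measurable fun p : (ℕ → ℕ) × (ℕ → ℝ) => S (p.1 j, p.2) := fun j =>
    hS.comp (((measurable_pi_apply j).comp measurable_fst).prodMk measurable_snd)
  have hF : Measurable F := by
    simp only [F]
    refine Complex.measurable_exp.comp (Measurable.mul_const (Complex.measurable_ofReal.comp ?_) _)
    exact Finset.measurable_sum _ fun j _ => ((hSj (j + 1)).sub (hSj j)).const_mul (c j)
  have hC : ∀ p, ‖F p‖ ≤ 1 := fun p => (Complex.norm_exp_ofReal_mul_I _).le
  -- Independence of `N` and `J` allows integrating over the jumps with the counts frozen; what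
  -- remains is a product of powers with the increments of `N` as exponents.
  have hind : IndepFun (fun ω j => N (τ j) ω) (fun ω m => J m ω) P :=
    hNJ.comp (φ := fun (x : ℝ≥0 → ℕ) j => x (τ j)) (ψ := id)
      (measurable_pi_lambda _ fun j => measurable_pi_apply (τ j)) measurable_id
  have hstep := hind.integral_comp_prodMk (measurable_pi_lambda _ fun j => hN.measurable (τ j))
    (measurable_pi_lambda _ hJm) hF hC
  rw [← hN.integral_prod_pow hτ (fun j => charFun ν (c j)) n]
  calc _ = ∫ ω, F (fun j => N (τ j) ω, fun m => J m ω) ∂P := by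
        refine integral_congr_ae ?_
        filter_upwards [hZeq] with ω hω
        simp only [F, S, hω]
    _ = _ := by
        rw [hstep]
        refine integral_congr_ae ?_
        filter_upwards [hN.mono] with ω hω
        obtain ⟨w, hw1, hw2⟩ := exists_weights_sum_increments (g := charFun ν) c
          (v := fun j => N (τ j) ω) (fun i j hij => hω (hτ hij)) n
        rw [← hw2, ← integral_exp_sum_iIndepFun hJm hJlaw hJ]
        simp only [F, S, hw1]

end

/-! ### Variation of constants along the paths, and splitting past from future -/

section

open Filter Topology

variable {Ω : Type*} [MeasurableSpace Ω] {P : Measure Ω} {ν : Measure ℝ} {lam : ℝ≥0}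
  {k : ℝ} {X Z : ℝ≥0 → Ω → ℝ}

theorem IsCompoundPoissonProcess.aemeasurable (hZ : IsCompoundPoissonProcess lam ν Z P)
    (t : ℝ≥0) : AEMeasurable (Z t) P := by
  obtain ⟨N, J, hN, hJm, -, -, -, hZeq⟩ := hZ
  let S : ℕ × Ω → ℝ := fun p => ∑ m ∈ Finset.range p.1, J m p.2
  have hS : Measurable S := measurable_from_prod_countable_right fun m => by
    simp only [S]; fun_prop
  refine ⟨fun ω => S (N t ω, ω), hS.comp ((hN.measurable t).prodMk measurable_id), ?_⟩
  filter_upwards [hZeq] with ω hω using hω t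

/-- The paths of a compound Poisson process are right-continuous and locally bounded. -/
theorem IsCompoundPoissonProcess.ae_rightContinuous_bounded
    (hZ : IsCompoundPoissonProcess lam ν Z P) :
    ∀ᵐ ω ∂P, (∀ t, ContinuousWithinAt (fun r => Z r ω) (Set.Ici t) t) ∧
      ∀ b, ∃ M, ∀ t ≤ b, |Z t ω| ≤ M := by
  obtain ⟨N, J, hN, -, -, -, -, hZeq⟩ := hZ
  filter_upwards [hZeq, hN.mono, hN.rightCont] with ω hω hmono hrc
  refine ⟨fun t => ?_, fun b => ⟨∑ m ∈ Finset.range (N b ω), |J m ω|, fun t ht => ?_⟩⟩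
  · simp only [hω]
    exact (continuous_of_discreteTopology (f := fun n : ℕ =>
      ∑ m ∈ Finset.range n, J m ω)).continuousAt.comp_continuousWithinAt (hrc t)
  · rw [hω]
    exact (Finset.abs_sum_le_sum_abs _ _).trans (Finset.sum_le_sum_of_subset_of_nonneg
      (Finset.range_mono (hmono ht)) fun _ _ _ => abs_nonneg _)

/-- This is variation of constants from time `a` to `a + h`, with the integral against `Z` realized
as a limit of grid sums. -/
theorem SolvesOU.ae_tendsto_sum_increments (hk : 0 ≤ k) (hZ : IsCompoundPoissonProcess lam ν Z P)
    (hX : SolvesOU k Z X P) (a h : ℝ≥0) :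
    ∀ᵐ ω ∂P, Tendsto (fun n : ℕ => ∑ j ∈ Finset.range n,
      Real.exp (-(k * (h - j * (h / n)))) *
        (Z (a + (j + 1 : ℕ) * (h / n)) ω - Z (a + j * (h / n)) ω)) atTop
      (𝓝 (X (a + h) ω - Real.exp (-(k * h)) * X a ω)) := by
  filter_upwards [hX.integrable, hX.equation, hZ.ae_rightContinuous_bounded] with ω hint heq hω
  obtain ⟨hrc, hbd⟩ := hω
  obtain ⟨M, hM⟩ := hbd (a + h)
  have hah : (a : ℝ) ≤ (a + h : ℝ≥0) := by exact_mod_cast le_self_add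
  have hI := (hint a).symm.trans (hint (a + h))
  have hgrid : ∀ (n j : ℕ), ((a : ℝ) + j * (h / n)).toNNReal = a + j * (h / n) := fun n j => by
    rw [← Real.toNNReal_coe (r := a + j * (h / n))]
    push_cast
    rfl
  have key := tendsto_stieltjesSum_of_linear_equation (z := fun r => Z r.toNNReal ω)
    -- Restarting the equation at time `a` moves the integral over `[0, a]` into the constant.
    (C := X 0 ω - k * ∫ r in (0 : ℝ)..(a : ℝ), X r.toNNReal ω) (M := M) hk hah hI
    (fun r hr => by
      have hr0 : 0 ≤ r := a.2.trans hr.1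
      have e := heq r.toNNReal
      rw [Real.coe_toNNReal r hr0] at e
      have hr' := hint r.toNNReal
      rw [Real.coe_toNNReal r hr0] at hr'
      rw [e, ← intervalIntegral.integral_add_adjacent_intervals (hint a)
        ((hint a).symm.trans hr')]
      ring)
    (fun r hr => (hrc r.toNNReal).comp (f := Real.toNNReal)
      continuous_real_toNNReal.continuousWithinAt fun y hy => Real.toNNReal_le_toNNReal hy.1)
    (fun r hr => hM _ (Real.toNNReal_le_iff_le_coe.2 hr.2))
  simp only [NNReal.coe_add, add_sub_cancel_left, hgrid, Real.toNNReal_coe] at key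
  have hah' : ((a : ℝ) + h).toNNReal = a + h := by
    rw [← NNReal.coe_add, Real.toNNReal_coe]
  simp only [hah', add_sub_add_left_eq_sub] at key
  exact key

/-- The joint characteristic function of the increments of a compound Poisson process and of an
independent variable. -/
theorem IsCompoundPoissonProcess.integral_exp_initial_add_increments
    [IsProbabilityMeasure P] [IsProbabilityMeasure ν]
    (hZ : IsCompoundPoissonProcess lam ν Z P) {Y : Ω → ℝ} (hY : Measurable Y)
    (hind : IndepFun Y (fun ω t => Z t ω) P) {τ : ℕ → ℝ≥0} (hτ : Monotone τ) (c : ℕ → ℝ) (u : ℝ)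
    (n : ℕ) :
    ∫ ω, Complex.exp ((u * Y ω + ∑ j ∈ Finset.range n, c j * (Z (τ (j + 1)) ω - Z (τ j) ω) : ℝ) *
        Complex.I) ∂P =
      (∫ ω, Complex.exp ((u * Y ω : ℝ) * Complex.I) ∂P) * ∏ j ∈ Finset.range n,
        Complex.exp (lam * ((τ (j + 1) : ℝ) - τ j : ℝ) * (charFun ν (c j) - 1)) := by
  rw [← hZ.integral_exp_sum_increments hτ c n]
  have hm := hZ.aemeasurable
  have hi := hind.comp (φ := fun y => Complex.exp ((u * y : ℝ) * Complex.I))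
    (ψ := fun z : ℝ≥0 → ℝ => Complex.exp ((∑ j ∈ Finset.range n,
      c j * (z (τ (j + 1)) - z (τ j)) : ℝ) * Complex.I)) (by fun_prop) (by fun_prop)
  refine Eq.trans ?_ (hi.integral_fun_mul_eq_mul_integral ?_ ?_)
  · congr 1 with ω
    simp only [Function.comp]
    rw [← Complex.exp_add]
    push_cast
    ring_nf
  · exact Measurable.aestronglyMeasurable (by fun_prop)
  · refine (Complex.measurable_exp.comp_aemeasurable (AEMeasurable.mul_const
      (Complex.measurable_ofReal.comp_aemeasurable ?_) _)).aestronglyMeasurable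
    exact Finset.aemeasurable_fun_sum _ fun j _ => ((hm _).sub (hm _)).const_mul (c j)

/-- Splitting off the increments of the last `m` cells of a grid with mesh `h` before and `h'` after
time `s`. -/
theorem IsCompoundPoissonProcess.integral_exp_initial_add_grid_increments
    [IsProbabilityMeasure P] [IsProbabilityMeasure ν]
    (hZ : IsCompoundPoissonProcess lam ν Z P) {Y : Ω → ℝ} (hY : Measurable Y)
    (hind : IndepFun Y (fun ω t => Z t ω) P) {s h h' : ℝ≥0} {n : ℕ} (hs : n * h = s)
    (c d : ℕ → ℝ) (u : ℝ) (m : ℕ) :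
    ∫ ω, Complex.exp ((u * Y ω + ∑ j ∈ Finset.range n,
        c j * (Z ((j + 1 : ℕ) * h) ω - Z (j * h) ω) + ∑ j ∈ Finset.range m,
        d j * (Z (s + (j + 1 : ℕ) * h') ω - Z (s + j * h') ω) : ℝ) * Complex.I) ∂P =
      (∫ ω, Complex.exp ((u * Y ω + ∑ j ∈ Finset.range n,
        c j * (Z ((j + 1 : ℕ) * h) ω - Z (j * h) ω) : ℝ) * Complex.I) ∂P) *
      ∏ j ∈ Finset.range m, Complex.exp (lam * h' * (charFun ν (d j) - 1)) := by
  -- The two grids are concatenated: `j` runs through mesh `h` up to index `n`, where the time is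
  -- `s`, and truncated subtraction starts mesh `h'` there.
  let τ : ℕ → ℝ≥0 := fun j => (min j n : ℕ) * h + (j - n : ℕ) * h'
  have hτ : Monotone τ := fun i j hij => by
    simp only [τ]
    gcongr
  have hl : ∀ {j}, j ≤ n → τ j = j * h := fun {j} hj => by
    simp only [τ, min_eq_left hj, Nat.sub_eq_zero_of_le hj, Nat.cast_zero, zero_mul, add_zero]
  have hr : ∀ j, τ (n + j) = s + j * h' := fun j => by
    simp [τ, hs]
  let w : ℕ → ℝ := fun j => if j < n then c j else d (j - n)
  have hwl : ∀ {j}, j < n → w j = c j := fun hj => if_pos hj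
  have hwr : ∀ j, w (n + j) = d j := fun j => by simp [w]
  have hsl : ∀ ω, ∑ j ∈ Finset.range n, w j * (Z (τ (j + 1)) ω - Z (τ j) ω) =
      ∑ j ∈ Finset.range n, c j * (Z ((j + 1 : ℕ) * h) ω - Z (j * h) ω) := fun ω =>
    Finset.sum_congr rfl fun j hj => by
      have hj := Finset.mem_range.1 hj
      rw [hwl hj, hl hj.le, hl hj]
  have h1 := hZ.integral_exp_initial_add_increments hY hind hτ w u (n + m)
  have h2 := hZ.integral_exp_initial_add_increments hY hind hτ w u n
  -- The first `n` factors are reassembled into the integral over the past alone.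
  rw [Finset.prod_range_add, ← mul_assoc, ← h2] at h1
  simp only [Finset.sum_range_add, hsl, hwr, add_assoc, hr] at h1
  simp only [add_assoc]
  rw [h1]
  congr 1
  refine Finset.prod_congr rfl fun j _ => ?_
  push_cast
  ring_nf

end

/-! ### Joint law of the state and the increment, and conditioning -/

section

open Filter Topology

variable {Ω : Type*} [MeasurableSpace Ω] {P : Measure Ω} {ν : Measure ℝ} {lam : ℝ≥0}
  {k : ℝ} {X Z : ℝ≥0 → Ω → ℝ}

/-- The product is the exponential of `lam` times a Riemann sum of a continuous function. -/
theorem tendsto_prod_exp_charFun [IsProbabilityMeasure ν] (lam t : ℝ≥0) (k v : ℝ) :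
    Tendsto (fun n : ℕ => ∏ j ∈ Finset.range n, Complex.exp (lam * (t / n : ℝ≥0) *
      (charFun ν (v * Real.exp (-(k * (t - j * (t / n))))) - 1))) atTop
      (𝓝 (Complex.exp (lam * ∫ r in (0 : ℝ)..t,
        (charFun ν (v * Real.exp (-(k * (t - r)))) - 1)))) := by
  have hf : Continuous fun r : ℝ => charFun ν (v * Real.exp (-(k * (t - r)))) - 1 :=
    ((continuous_charFun (μ := ν)).comp (by fun_prop)).sub continuous_const
  have h := tendsto_riemannSum_of_continuous (a := 0) (b := t) t.coe_nonneg hf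
  refine ((Complex.continuous_exp.tendsto _).comp (h.const_mul (lam : ℂ))).congr fun n => ?_
  simp only [Function.comp, Finset.mul_sum, Complex.exp_sum]
  refine Finset.prod_congr rfl fun j _ => ?_
  simp only [Complex.real_smul, sub_zero, zero_add]
  push_cast
  rw [mul_assoc]

/-- The joint characteristic function of `X s` and `X (s + t) - e ^ (-k t) X s` for an
Ornstein-Uhlenbeck process driven by a compound Poisson process. -/
theorem SolvesOU.integral_exp_increment [IsProbabilityMeasure P] [IsProbabilityMeasure ν]
    (hk : 0 ≤ k) (hZ : IsCompoundPoissonProcess lam ν Z P) (hX : SolvesOU k Z X P)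
    (hind : IndepFun (X 0) (fun ω t => Z t ω) P) (s t : ℝ≥0) (u v : ℝ) :
    ∫ ω, Complex.exp ((u * X s ω + v * (X (s + t) ω - Real.exp (-(k * t)) * X s ω) : ℝ) *
        Complex.I) ∂P =
      (∫ ω, Complex.exp ((u * X s ω : ℝ) * Complex.I) ∂P) *
        Complex.exp (lam * ∫ r in (0 : ℝ)..t,
          (charFun ν (v * Real.exp (-(k * (t - r)))) - 1)) := by
  let c : ℕ → ℕ → ℝ := fun n j => Real.exp (-(k * (s - j * (s / n))))
  let d : ℕ → ℕ → ℝ := fun n j => Real.exp (-(k * (t - j * (t / n))))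
  -- `A n` approximates `u * X s` by `X 0` and increments before `s`; `D n` approximates `v` times
  -- the OU increment by increments of `Z` after `s`.
  let A : ℕ → Ω → ℝ := fun n ω => u * Real.exp (-(k * s)) * X 0 ω + ∑ j ∈ Finset.range n,
    u * c n j * (Z ((j + 1 : ℕ) * (s / n)) ω - Z (j * (s / n)) ω)
  let D : ℕ → Ω → ℝ := fun n ω => ∑ j ∈ Finset.range n,
    v * d n j * (Z (s + (j + 1 : ℕ) * (t / n)) ω - Z (s + j * (t / n)) ω)
  have hZm := hZ.aemeasurable
  have hAm : ∀ n, AEMeasurable (A n) P := fun n =>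
    ((hX.measurable 0).const_mul _).aemeasurable.add
      (Finset.aemeasurable_fun_sum _ fun j _ => ((hZm _).sub (hZm _)).const_mul _)
  have hDm : ∀ n, AEMeasurable (D n) P := fun n =>
    Finset.aemeasurable_fun_sum _ fun j _ => ((hZm _).sub (hZm _)).const_mul _
  have hA : ∀ᵐ ω ∂P, Tendsto (fun n => A n ω) atTop (𝓝 (u * X s ω)) := by
    filter_upwards [hX.ae_tendsto_sum_increments hk hZ 0 s] with ω hω
    have h := (hω.const_mul u).const_add (u * Real.exp (-(k * s)) * X 0 ω)
    simp only [zero_add, Finset.mul_sum, ← mul_assoc] at h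
    convert h using 2
    ring
  have hD : ∀ᵐ ω ∂P, Tendsto (fun n => D n ω) atTop
      (𝓝 (v * (X (s + t) ω - Real.exp (-(k * t)) * X s ω))) := by
    filter_upwards [hX.ae_tendsto_sum_increments hk hZ s t] with ω hω
    have h := hω.const_mul v
    simp only [Finset.mul_sum, ← mul_assoc v] at h
    exact h
  have hlim : ∀ {Y : ℕ → Ω → ℝ} {W : Ω → ℝ}, (∀ n, AEMeasurable (Y n) P) →
      (∀ᵐ ω ∂P, Tendsto (fun n => Y n ω) atTop (𝓝 (W ω))) →
      Tendsto (fun n => ∫ ω, Complex.exp ((Y n ω : ℝ) * Complex.I) ∂P) atTop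
        (𝓝 (∫ ω, Complex.exp ((W ω : ℝ) * Complex.I) ∂P)) := fun {Y W} hY hW => by
    refine tendsto_integral_of_dominated_convergence (fun _ => 1) (fun n => ?_)
      (integrable_const _) (fun n => .of_forall fun ω => (Complex.norm_exp_ofReal_mul_I _).le) ?_
    · exact (Complex.measurable_exp.comp_aemeasurable (AEMeasurable.mul_const
        (Complex.measurable_ofReal.comp_aemeasurable (hY n)) _)).aestronglyMeasurable
    · filter_upwards [hW] with ω hω
      exact (Continuous.tendsto (by fun_prop : Continuous fun x : ℝ =>
        Complex.exp ((x : ℝ) * Complex.I)) _).comp hω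
  refine tendsto_nhds_unique (hlim (fun n => (hAm n).add (hDm n)) ?_)
    (((hlim hAm hA).mul (tendsto_prod_exp_charFun (ν := ν) lam t k v)).congr' ?_)
  · filter_upwards [hA, hD] with ω h1 h2 using h1.add h2
  -- The grid of mesh `s / n` reaches `s` after `n` steps only for `n ≠ 0`.
  · filter_upwards [eventually_gt_atTop 0] with n hn
    have hn' : (n : ℝ≥0) ≠ 0 := by exact_mod_cast hn.ne'
    have h := hZ.integral_exp_initial_add_grid_increments (hX.measurable 0) hind
      (s := s) (h := s / n) (h' := t / n) (n := n) (mul_div_cancel₀ _ hn')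
      (fun j => u * c n j) (fun j => v * d n j) (u * Real.exp (-(k * s))) n
    exact h.symm

/-- A factorization of the joint characteristic function gives independence and the law of the
second variable. -/
theorem indepFun_and_hasLaw_of_integral_exp [IsProbabilityMeasure P] {U V : Ω → ℝ}
    (hU : Measurable U) (hV : Measurable V) {μ : Measure ℝ} [IsProbabilityMeasure μ]
    (h : ∀ u v : ℝ, ∫ ω, Complex.exp ((u * U ω + v * V ω : ℝ) * Complex.I) ∂P =
      (∫ ω, Complex.exp ((u * U ω : ℝ) * Complex.I) ∂P) * charFun μ v) :
    IndepFun U V P ∧ HasLaw V μ P := by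
  have := Measure.isProbabilityMeasure_map (μ := P) hV.aemeasurable
  have hchar : ∀ {W : Ω → ℝ}, Measurable W → ∀ u : ℝ,
      charFun (P.map W) u = ∫ ω, Complex.exp ((u * W ω : ℝ) * Complex.I) ∂P := fun {W} hW u => by
    rw [charFun_apply_real, integral_map hW.aemeasurable (by fun_prop)]
    push_cast
    rfl
  have hlaw : P.map V = μ := by
    -- Setting `u = 0` in the factorization isolates the characteristic function of `V`.
    refine Measure.ext_of_charFun (funext fun v => ?_)
    rw [hchar hV]
    simpa using h 0 v
  refine ⟨(indepFun_iff_charFun_prod hU.aemeasurable hV.aemeasurable).2 fun p => ?_,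
    ⟨hV.aemeasurable, hlaw⟩⟩
  rw [hlaw, hchar hU, ← h, charFun_apply, integral_map (by fun_prop) (by fun_prop)]
  congr 1 with ω

/-- The factor depending on `U` is pulled out of the conditional expectation, and the factor
depending on the independent `V` is replaced by its mean. -/
theorem condExp_exp_of_indepFun [IsProbabilityMeasure P] {U V : Ω → ℝ} (hU : Measurable U)
    (hV : Measurable V) (h : IndepFun U V P) {μ : Measure ℝ} (hlaw : HasLaw V μ P) (a u : ℝ) :
    P[fun ω => Complex.exp ((u * (a * U ω + V ω) : ℝ) * Complex.I) |
        MeasurableSpace.comap U inferInstance]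
      =ᵐ[P] fun ω => Complex.exp ((u * (a * U ω) : ℝ) * Complex.I) * charFun μ u := by
  let f : Ω → ℂ := fun ω => Complex.exp ((u * (a * U ω) : ℝ) * Complex.I)
  let g : Ω → ℂ := fun ω => Complex.exp ((u * V ω : ℝ) * Complex.I)
  have hle : MeasurableSpace.comap U inferInstance ≤ (inferInstance : MeasurableSpace Ω) :=
    hU.comap_le
  have hU' : Measurable[MeasurableSpace.comap U inferInstance] U := comap_measurable U
  have hf : StronglyMeasurable[MeasurableSpace.comap U inferInstance] f :=
    ((by fun_prop : Measurable fun x : ℝ =>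
      Complex.exp ((u * (a * x) : ℝ) * Complex.I)).comp hU').stronglyMeasurable
  have hint : ∀ {W : Ω → ℝ}, Measurable W →
      Integrable (fun ω => Complex.exp ((W ω : ℝ) * Complex.I)) P := fun {W} hW =>
    .of_bound (by fun_prop) 1 (.of_forall fun ω => (Complex.norm_exp_ofReal_mul_I _).le)
  have hfg : (fun ω => Complex.exp ((u * (a * U ω + V ω) : ℝ) * Complex.I)) =
      fun ω => ContinuousLinearMap.mul ℝ ℂ (f ω) (g ω) := by
    ext ω
    simp only [f, g, ContinuousLinearMap.mul_apply']
    rw [← Complex.exp_add]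
    push_cast
    ring_nf
  have hV' : Measurable[MeasurableSpace.comap V inferInstance] V := comap_measurable V
  have hg : StronglyMeasurable[MeasurableSpace.comap V inferInstance] g :=
    ((by fun_prop : Measurable fun x : ℝ =>
      Complex.exp ((u * x : ℝ) * Complex.I)).comp hV').stronglyMeasurable
  have hindep : Indep (MeasurableSpace.comap V inferInstance)
      (MeasurableSpace.comap U inferInstance) P := (IndepFun_iff_Indep _ _ _).1 h.symm
  have hge := condExp_indep_eq hV.comap_le hle hg hindep
  have hgint : ∫ ω, g ω ∂P = charFun μ u := by
    rw [charFun_apply_real, ← hlaw.map_eq, integral_map hV.aemeasurable (by fun_prop)]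
    simp only [g]
    push_cast
    rfl
  rw [hfg]
  have hpull := condExp_bilin_of_stronglyMeasurable_left (μ := P) (ContinuousLinearMap.mul ℝ ℂ)
    hf (g := g) (hfg ▸ hint (by fun_prop)) (hint (by fun_prop))
  filter_upwards [hpull, hge] with ω h1 h2
  rw [h1, h2, hgint]
  rfl

end

/-! ### Laplace jumps and the conclusion -/

/-- Substituting `r = t - t w` makes the damping factor `e ^ (-k t w)`, and damping the frequency by
it amounts to multiplying the rate `β` by `e ^ (k t w)`. -/
theorem integral_charFun_laplaceMeasure {β : ℝ} (hβ : 0 < β) (k t u : ℝ) :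
    ∫ r in (0 : ℝ)..t,
      (charFun (laplaceMeasure β) (u * Real.exp (-(k * (t - r)))) - 1) =
      t * (phiL β k t u - 1) := by
  let f : ℝ → ℝ := fun r => β ^ 2 / (β ^ 2 + (u * Real.exp (-(k * (t - r)))) ^ 2)
  have hf : Continuous f := by
    refine Continuous.div (by fun_prop) (by fun_prop) fun r => ?_
    positivity
  have h1 : ∀ r, charFun (laplaceMeasure β) (u * Real.exp (-(k * (t - r)))) - 1 =
      ((f r - 1 : ℝ) : ℂ) := fun r => by
    rw [charFun_laplaceMeasure hβ]
    simp [f]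
  simp_rw [h1]
  have h2 : t * phiL β k t u = ∫ r in (0 : ℝ)..t, f r := by
    -- The factor `t` stays outside the integral, so `t = 0` needs no separate case.
    have h := intervalIntegral.mul_integral_comp_sub_mul (f := f) (a := 0) (b := 1) t t
    simp only [mul_one, sub_self, mul_zero, sub_zero] at h
    rw [← h, phiL]
    congr 2 with w
    simp only [f]
    have e : (u * Real.exp (-(k * (t - (t - t * w))))) ^ 2 =
        u ^ 2 * Real.exp (-(2 * k * t * w)) := by
      rw [mul_pow, ← Real.exp_nat_mul]
      push_cast
      ring_nf
    rw [e, Real.exp_neg]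
    have := Real.exp_pos (2 * k * t * w)
    field_simp
  rw [intervalIntegral.integral_ofReal, intervalIntegral.integral_sub
    (hf.intervalIntegrable _ _) intervalIntegrable_const, ← h2, intervalIntegral.integral_const]
  push_cast
  simp
  ring

/-- Conditional characteristic function of the symmetric bilateral-gamma Ornstein-Uhlenbeck
process: the formula itself; the identification of its factors as characteristic functions of a
uniform mixture of centered Laplace laws and of the compound Poisson law with these jumps; and the
law of the increment `X(t + s) - e^{-k t} X(s)`, which is independent of `X(s)`. -/
theorem mainTheorem10 {Ω : Type*} [MeasurableSpace Ω] (P : Measure Ω) [IsProbabilityMeasure P]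
    (k : ℝ) (lam : ℝ≥0) (β : ℝ) (hk : 0 < k) (hlam : 0 < lam) (hβ : 0 < β)
    (X : ℝ≥0 → Ω → ℝ) (hX : IsSymmetricBGammaOU k lam β X P) (s t : ℝ≥0) :
    (∀ u : ℝ,
      P[fun ω => Complex.exp (Complex.I * u * X (t + s) ω) |
          MeasurableSpace.comap (X s) inferInstance]
        =ᵐ[P] fun ω => Complex.exp (Complex.I * u * X s ω * Real.exp (-(k * t))) *
          Complex.exp (lam * t * (phiL β k t u - 1))) ∧
    (∀ u : ℝ, charFun (laplaceMixture β (k * t)) u = phiL β k t u) ∧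
    (∀ u : ℝ, charFun (compoundPoissonMeasure (lam * t) (laplaceMixture β (k * t))) u =
      Complex.exp (lam * t * (phiL β k t u - 1))) ∧
    IndepFun (X s) (fun ω => X (t + s) ω - Real.exp (-(k * t)) * X s ω) P ∧
    HasLaw (fun ω => X (t + s) ω - Real.exp (-(k * t)) * X s ω)
      (compoundPoissonMeasure (lam * t) (laplaceMixture β (k * t))) P := by
  obtain ⟨Z, hZ, hind, hOU⟩ := hX
  have := isProbabilityMeasure_laplaceMeasure hβ
  have := isProbabilityMeasure_laplaceMixture hβ (k * t)
  have := isProbabilityMeasure_compoundPoissonMeasure (lam * t) (laplaceMixture β (k * t))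
  have hmix := charFun_laplaceMixture hβ k t
  have hcp : ∀ u : ℝ, charFun (compoundPoissonMeasure (lam * t) (laplaceMixture β (k * t))) u =
      Complex.exp (lam * t * (phiL β k t u - 1)) := fun u => by
    rw [charFun_compoundPoissonMeasure, hmix]
    push_cast
    rfl
  have hD : Measurable fun ω => X (t + s) ω - Real.exp (-(k * t)) * X s ω :=
    (hOU.measurable _).sub ((hOU.measurable s).const_mul _)
  obtain ⟨hi, hlaw⟩ := indepFun_and_hasLaw_of_integral_exp (P := P) (hOU.measurable s) hD
    (μ := compoundPoissonMeasure (lam * t) (laplaceMixture β (k * t))) fun u v => by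
      rw [hcp, add_comm t s, hOU.integral_exp_increment hk.le hZ hind,
        integral_charFun_laplaceMeasure hβ, mul_assoc]
  refine ⟨fun u => ?_, hmix, hcp, hi, hlaw⟩
  -- Here `X (t + s)` is written as `e ^ (-k t) X s` plus the independent increment.
  have h := condExp_exp_of_indepFun (hOU.measurable s) hD hi hlaw (Real.exp (-(k * t))) u
  rw [hcp] at h
  convert h using 2 with ω
  · congr 1 with ω
    push_cast
    ring_nf
  · push_cast
    ring_nf
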